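/- Throughout, $\|\cdot\|$ is the Frobenius norm. Let $\mathcal M\subset\mathbb R^{m\times n}$ be the manifold of matrices of rank $r$ and, for $Y\in\mathcal M$, let $\mathrm P(Y)$ be the orthogonal projection (for the Frobenius inner product) onto the tangent space $T_Y\mathcal M$. **The integrator.** Let $F:[0,T]\times\mathbb R^{m\times n}\to\mathbb R^{m\times n}$. One step from $t_0$ to $t_1=t_0+h$ starts from $Y_0=U_0S_0V_0^\top$, where $U_0\in\mathbb R^{m\times r}$ and $V_0\in\mathbb R^{n\times r}$ have orthonormal columns and $S_0\in\mathbb R^{r\times r}$, and produces $Y_1=U_1S_1V_1^\top$ as follows. * K-step: solve $\dot K(t)=F(t,K(t)V_0^\top)V_0$, $K(t_0)=U_0S_0$, on $[t_0,t_1]$, and take a QR factorization $K(t_1)=U_1R_1$. * L-step: solve $\dot L(t)=F(t,U_0L(t)^\top)^\top U_0$, $L(t_0)=V_0S_0^\top$, on $[t_0,t_1]$, and take a QR factorization $L(t_1)=V_1\widetilde R_1$. * S-step: solve $\dot S(t)=U_1^\top F(t,U_1S(t)V_1^\top)V_1$, $S(t_0)=(U_1^\top U_0)\,S_0\,(V_1^\top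 V_0)^\top$, on $[t_0,t_1]$, and set $S_1=S(t_1)$. **Theorem.** For all real $L,B,T$ there are constants $c_0,c_1,c_2\ge 0$, depending only on $L$, $B$ and $T$, such that the following holds for all $m,n,r$ and $F$. Let $A:[0,T]\to\mathbb R^{m\times n}$ be a solution of $\dot A(t)=F(t,A(t))$, and let $\varepsilon\ge0$, $\delta$, $\rho$ and $h>0$ be such that 1. $\|F(t,Y)-F(t,\widetilde Y)\|\le L\|Y-\widetilde Y\|$ and $\|F(t,Y)\|\le B$ for all $Y,\widetilde Y\in\mathbb R^{m\times n}$ and $0\le t\le T$; 2. $\|(I-\mathrm P(Y))F(t,Y)\|\le\varepsilon$ for all $0\le t\le T$ and all $Y\in\mathcal M$ with $\|Y-A(t)\|<\rho$; 3. $\|Y_0-A(0)\|\le\delta$, where $Y_0=U_0S_0V_0^\top$ is the starting value of the integrator; 4. the neighbourhood in 2 is large enough to contain the approximations: $c_0\delta+c_1\varepsilon+c_2h\le\rho$ (there is no restriction if 2 holds for all $Y\in\mathcal M$). Let $Y_k$ be the approximation after $k$ steps of the integrator with step size $h$. Then, for all $k$ with $t_k=kh\le T$, $$\|Y_k-A(t_k)\|\le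 c_0\delta+c_1\varepsilon+c_2h .$$ In particular, the constants do not depend on singular values of the exact or the approximate solution. -/

import Mathlib

open Set Filter Topology
open scoped Matrix Matrix.Norms.Frobenius

/-- The Frobenius inner product `⟪X, Y⟫ = tr (Xᵀ Y)` on real `m × n` matrices; its norm is
Mathlib's Frobenius norm. -/
noncomputable instance frobeniusInnerProductSpace (m n : ℕ) :
    InnerProductSpace ℝ (Matrix (Fin m) (Fin n) ℝ) where
  inner X Y := (Xᵀ * Y).trace
  norm_sq_eq_re_inner X := by
    have h0 : (0 : ℝ) ≤ ∑ i, ∑ j, X i j ^ 2 :=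
      Finset.sum_nonneg fun i _ => Finset.sum_nonneg fun j _ => sq_nonneg _
    have h1 : ‖X‖ = Real.sqrt (∑ i, ∑ j, X i j ^ 2) := by
      rw [Matrix.frobenius_norm_def, Real.sqrt_eq_rpow]
      simp
    rw [h1, Real.sq_sqrt h0, Finset.sum_comm]
    simp [Matrix.trace, Matrix.mul_apply, pow_two]
  conj_inner_symm X Y := by
    have h : (Yᵀ * X).trace = (Xᵀ * Y).trace := by
      rw [← Matrix.trace_transpose, Matrix.transpose_mul, Matrix.transpose_transpose]
    simpa using h
  add_left X Y Z := by
    simp [Matrix.add_mul]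
  smul_left X Y a := by
    simp

/-- The set of real `m × n` matrices of rank exactly `r`. -/
def rankManifold (m n r : ℕ) : Set (Matrix (Fin m) (Fin n) ℝ) :=
  {Y | Y.rank = r}

/-- The tangent space at `Y` of the manifold of rank-`r` matrices: the space of velocities
`γ'(0)` of curves `γ` of rank-`r` matrices with `γ(0) = Y`. -/
def rankTangentSpace {m n : ℕ} (r : ℕ) (Y : Matrix (Fin m) (Fin n) ℝ) :
    Submodule ℝ (Matrix (Fin m) (Fin n) ℝ) :=
  Submodule.span ℝ {W | ∃ γ : ℝ → Matrix (Fin m) (Fin n) ℝ,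
    γ 0 = Y ∧ (∀ᶠ s in 𝓝 (0 : ℝ), γ s ∈ rankManifold m n r) ∧ HasDerivAt γ W 0}

/-- `P(Y)`: the orthogonal projection (for the Frobenius inner product) onto the tangent space
at `Y` of the manifold of rank-`r` matrices. -/
noncomputable def tangentProj {m n : ℕ} (r : ℕ) (Y : Matrix (Fin m) (Fin n) ℝ) :
    Matrix (Fin m) (Fin n) ℝ →L[ℝ] Matrix (Fin m) (Fin n) ℝ :=
  (rankTangentSpace r Y).starProjection

/-- `X` solves the matrix differential equation `X'(t) = G(t, X(t))` on `[a, b]`. -/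
def IsSolutionOn {p q : ℕ} (G : ℝ → Matrix (Fin p) (Fin q) ℝ → Matrix (Fin p) (Fin q) ℝ)
    (a b : ℝ) (X : ℝ → Matrix (Fin p) (Fin q) ℝ) : Prop :=
  ∀ t ∈ Icc a b, HasDerivWithinAt X (G t (X t)) (Icc a b) t

/-- `Q` has orthonormal columns. -/
def HasOrthonormalCols {p r : ℕ} (Q : Matrix (Fin p) (Fin r) ℝ) : Prop :=
  Qᵀ * Q = 1

/-- `K = Q R` is a (slim) QR factorization: `Q` has orthonormal columns and the square matrix
`R` is upper triangular. -/
def IsQR {p r : ℕ} (K Q : Matrix (Fin p) (Fin r) ℝ) (R : Matrix (Fin r) (Fin r) ℝ) : Prop :=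
  K = Q * R ∧ HasOrthonormalCols Q ∧ ∀ i j, j < i → R i j = 0

/-- One step of the integrator from `t₀` to `t₀ + h`, leading from the factors
`(U₀, S₀, V₀)` to `(U₁, S₁, V₁)`. Any QR factorizations may be chosen in the K- and L-steps. -/
def IsIntegratorStep {m n r : ℕ}
    (F : ℝ → Matrix (Fin m) (Fin n) ℝ → Matrix (Fin m) (Fin n) ℝ) (t₀ h : ℝ)
    (U₀ : Matrix (Fin m) (Fin r) ℝ) (S₀ : Matrix (Fin r) (Fin r) ℝ)
    (V₀ : Matrix (Fin n) (Fin r) ℝ)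
    (U₁ : Matrix (Fin m) (Fin r) ℝ) (S₁ : Matrix (Fin r) (Fin r) ℝ)
    (V₁ : Matrix (Fin n) (Fin r) ℝ) : Prop :=
  -- K-step
  (∃ (K : ℝ → Matrix (Fin m) (Fin r) ℝ) (R : Matrix (Fin r) (Fin r) ℝ),
    IsSolutionOn (fun t X => F t (X * V₀ᵀ) * V₀) t₀ (t₀ + h) K ∧
    K t₀ = U₀ * S₀ ∧
    IsQR (K (t₀ + h)) U₁ R) ∧
  -- L-step
  (∃ (L : ℝ → Matrix (Fin n) (Fin r) ℝ) (R : Matrix (Fin r) (Fin r) ℝ),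
    IsSolutionOn (fun t X => (F t (U₀ * Xᵀ))ᵀ * U₀) t₀ (t₀ + h) L ∧
    L t₀ = V₀ * S₀ᵀ ∧
    IsQR (L (t₀ + h)) V₁ R) ∧
  -- S-step
  (∃ S : ℝ → Matrix (Fin r) (Fin r) ℝ,
    IsSolutionOn (fun t X => U₁ᵀ * F t (U₁ * X * V₁ᵀ) * V₁) t₀ (t₀ + h) S ∧
    S t₀ = (U₁ᵀ * U₀) * S₀ * (V₁ᵀ * V₀)ᵀ ∧
    S (t₀ + h) = S₁)

/-! ### Frobenius norm and orthonormal columns -/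

/-! Write `e` for a bound on the error at the start `a` of a step and compare the new value with `W
= Y₀ + A(a+h) - A(a)`. With this shift the old error is passed on with factor exactly 1, and
everything else is `O(h (e + h + ε))`, so a discrete Gronwall argument applies.

The new bases almost capture `W`. The part of `(1 - U₁U₁ᵀ) W` along `V₀` is small because `A V₀ - K`
has a small derivative and `K(a+h)` lies in the range of `U₁`. For the part across `V₀`, the `Y₀`
term drops out and there remains the increment of `(1 - U₁U₁ᵀ) A (1 - V₀V₀ᵀ)`. Its derivative is
close to the same double projection of `F` at a matrix `U₁ R' V₀ᵀ`. Tangent vectors there are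
annihilated by this projection (`complProj_mul_tangent_mul_complProj`), so only the `ε`-small normal
part of `F` survives. The bound needs `R'` invertible but never the size of its inverse; hence
singular values do not enter. This is `norm_complProj_mul_le_of_KStep`; its transpose treats `V₁`.

The S-step is a Galerkin approximation in these bases, which gives the recursion
`norm_integratorStep_sub_le`. -/

theorem frobenius_norm_sq_eq_trace {m n : ℕ} (X : Matrix (Fin m) (Fin n) ℝ) :
    ‖X‖ ^ 2 = (Xᵀ * X).trace :=
  (frobeniusInnerProductSpace m n).norm_sq_eq_re_inner X

/-- Pythagoras for the range of `U` and its orthogonal complement; both contraction estimates below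
follow from it. -/
theorem norm_transpose_mul_sq_add {m n r : ℕ} {U : Matrix (Fin m) (Fin r) ℝ}
    (hU : HasOrthonormalCols U) (X : Matrix (Fin m) (Fin n) ℝ) :
    ‖Uᵀ * X‖ ^ 2 + ‖(1 - U * Uᵀ) * X‖ ^ 2 = ‖X‖ ^ 2 := by
  have hU' : Uᵀ * U = 1 := hU
  have hP : (1 - U * Uᵀ)ᵀ * (1 - U * Uᵀ) = 1 - U * Uᵀ := by
    have : U * Uᵀ * (U * Uᵀ) = U * Uᵀ := by
      rw [Matrix.mul_assoc, ← Matrix.mul_assoc Uᵀ, hU', Matrix.one_mul]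
    simp [Matrix.transpose_sub, Matrix.mul_sub, Matrix.sub_mul, this]
  simp only [frobenius_norm_sq_eq_trace]
  rw [← Matrix.trace_add]
  congr 1
  calc (Uᵀ * X)ᵀ * (Uᵀ * X) + ((1 - U * Uᵀ) * X)ᵀ * ((1 - U * Uᵀ) * X)
      = Xᵀ * (U * Uᵀ) * X + Xᵀ * ((1 - U * Uᵀ)ᵀ * (1 - U * Uᵀ)) * X := by
        simp only [Matrix.transpose_mul, Matrix.transpose_transpose, Matrix.mul_assoc]
    _ = Xᵀ * X := by
        rw [hP]
        simp [Matrix.mul_sub, Matrix.sub_mul]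

theorem norm_transpose_mul_le {m n r : ℕ} {U : Matrix (Fin m) (Fin r) ℝ}
    (hU : HasOrthonormalCols U) (X : Matrix (Fin m) (Fin n) ℝ) : ‖Uᵀ * X‖ ≤ ‖X‖ :=
  abs_le_of_sq_le_sq' (by nlinarith [norm_transpose_mul_sq_add hU X]) (norm_nonneg _) |>.2

theorem norm_complProj_mul_le {m n r : ℕ} {U : Matrix (Fin m) (Fin r) ℝ}
    (hU : HasOrthonormalCols U) (X : Matrix (Fin m) (Fin n) ℝ) :
    ‖(1 - U * Uᵀ) * X‖ ≤ ‖X‖ :=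
  abs_le_of_sq_le_sq' (by nlinarith [norm_transpose_mul_sq_add hU X]) (norm_nonneg _) |>.2

theorem norm_mul_left_eq {m n r : ℕ} {U : Matrix (Fin m) (Fin r) ℝ}
    (hU : HasOrthonormalCols U) (X : Matrix (Fin r) (Fin n) ℝ) : ‖U * X‖ = ‖X‖ := by
  have hU' : Uᵀ * U = 1 := hU
  refine (sq_eq_sq₀ (norm_nonneg _) (norm_nonneg _)).1 ?_
  rw [frobenius_norm_sq_eq_trace, frobenius_norm_sq_eq_trace, Matrix.transpose_mul,
    Matrix.mul_assoc, ← Matrix.mul_assoc Uᵀ, hU', Matrix.one_mul]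

theorem norm_mul_le_of_orthonormal {m n r : ℕ} {V : Matrix (Fin n) (Fin r) ℝ}
    (hV : HasOrthonormalCols V) (X : Matrix (Fin m) (Fin n) ℝ) : ‖X * V‖ ≤ ‖X‖ := by
  rw [← Matrix.frobenius_norm_transpose (X * V), ← Matrix.frobenius_norm_transpose X,
    Matrix.transpose_mul]
  exact norm_transpose_mul_le hV _

theorem norm_mul_complProj_le {m n r : ℕ} {V : Matrix (Fin n) (Fin r) ℝ}
    (hV : HasOrthonormalCols V) (X : Matrix (Fin m) (Fin n) ℝ) :
    ‖X * (1 - V * Vᵀ)‖ ≤ ‖X‖ := by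
  rw [← Matrix.frobenius_norm_transpose (X * _), ← Matrix.frobenius_norm_transpose X,
    Matrix.transpose_mul]
  simpa using norm_complProj_mul_le hV Xᵀ

theorem norm_mul_transpose_eq {m n r : ℕ} {V : Matrix (Fin n) (Fin r) ℝ}
    (hV : HasOrthonormalCols V) (X : Matrix (Fin m) (Fin r) ℝ) : ‖X * Vᵀ‖ = ‖X‖ := by
  rw [← Matrix.frobenius_norm_transpose (X * _), ← Matrix.frobenius_norm_transpose X,
    Matrix.transpose_mul]
  simpa using norm_mul_left_eq hV Xᵀ

/-! ### Derivatives of matrix-valued curves -/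

theorem HasDerivWithinAt.matrix_mul_mul {m n p q : ℕ} {f : ℝ → Matrix (Fin m) (Fin n) ℝ}
    {f' : Matrix (Fin m) (Fin n) ℝ} {s : Set ℝ} {x : ℝ} (hf : HasDerivWithinAt f f' s x)
    (P : Matrix (Fin p) (Fin m) ℝ) (Q : Matrix (Fin n) (Fin q) ℝ) :
    HasDerivWithinAt (fun t => P * f t * Q) (P * f' * Q) s x := by
  let φ : Matrix (Fin m) (Fin n) ℝ →ₗ[ℝ] Matrix (Fin p) (Fin q) ℝ :=
    { toFun := fun X => P * X * Q
      map_add' := fun X Y => by rw [Matrix.mul_add, Matrix.add_mul]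
      map_smul' := fun c X => by simp }
  exact (LinearMap.toContinuousLinearMap φ).hasFDerivAt.comp_hasDerivWithinAt x hf

theorem HasDerivWithinAt.matrix_transpose {m n : ℕ} {f : ℝ → Matrix (Fin m) (Fin n) ℝ}
    {f' : Matrix (Fin m) (Fin n) ℝ} {s : Set ℝ} {x : ℝ} (hf : HasDerivWithinAt f f' s x) :
    HasDerivWithinAt (fun t => (f t)ᵀ) f'ᵀ s x :=
  (LinearMap.toContinuousLinearMap
    (Matrix.transposeLinearEquiv (Fin m) (Fin n) ℝ ℝ).toLinearMap).hasFDerivAt.comp_hasDerivWithinAt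
      x hf

theorem IsSolutionOn.mono {p q : ℕ}
    {G : ℝ → Matrix (Fin p) (Fin q) ℝ → Matrix (Fin p) (Fin q) ℝ} {a b a' b' : ℝ}
    {X : ℝ → Matrix (Fin p) (Fin q) ℝ} (hX : IsSolutionOn G a b X) (ha : a ≤ a') (hb : b' ≤ b) :
    IsSolutionOn G a' b' X := fun t ht =>
  (hX t (Icc_subset_Icc ha hb ht)).mono (Icc_subset_Icc ha hb)

/-- A curve with derivative bounded by `C` on `[a, a + h]` moves by at most `C h`. -/
theorem norm_sub_le_of_hasDerivWithinAt {E : Type*} [NormedAddCommGroup E] [NormedSpace ℝ E]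
    {f f' : ℝ → E} {a h C : ℝ} (hC : 0 ≤ C)
    (hf : ∀ t ∈ Icc a (a + h), HasDerivWithinAt f (f' t) (Icc a (a + h)) t)
    (hb : ∀ t ∈ Icc a (a + h), ‖f' t‖ ≤ C) :
    ∀ t ∈ Icc a (a + h), ‖f t - f a‖ ≤ C * h := fun t ht =>
  (norm_image_sub_le_of_norm_deriv_le_segment' hf (fun x hx => hb x (Ico_subset_Icc_self hx)) t
    ht).trans (mul_le_mul_of_nonneg_left (by linarith [ht.2]) hC)

/-! ### Tangent vectors of the rank-`r` manifold -/

/-- The determinant of `R + s • 1` is the characteristic polynomial of `-R` at `s`, which has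
finitely many roots. Needed because a QR factor may be singular, while the normal-part hypothesis
concerns matrices of rank exactly `r`. -/
theorem exists_det_ne_zero_norm_sub_le {r : ℕ} (R : Matrix (Fin r) (Fin r) ℝ) {η : ℝ}
    (hη : 0 < η) : ∃ R' : Matrix (Fin r) (Fin r) ℝ, R'.det ≠ 0 ∧ ‖R' - R‖ ≤ η := by
  have hfin : {s : ℝ | (-R).charpoly.IsRoot s}.Finite :=
    Polynomial.finite_setOfPred_isRoot (Matrix.charpoly_monic _).ne_zero
  have h1 : ∀ᶠ s in 𝓝[≠] (0 : ℝ), ¬ (-R).charpoly.IsRoot s := by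
    have hc : ({s : ℝ | (-R).charpoly.IsRoot s} \ {0})ᶜ ∈ 𝓝 (0 : ℝ) :=
      (hfin.subset sdiff_subset).isClosed.isOpen_compl.mem_nhds (by simp)
    filter_upwards [mem_nhdsWithin_of_mem_nhds hc, self_mem_nhdsWithin] with s hs hs0 hr
    exact hs ⟨hr, hs0⟩
  have h2 : ∀ᶠ s in 𝓝[≠] (0 : ℝ), ‖s • (1 : Matrix (Fin r) (Fin r) ℝ)‖ < η := by
    have hc : Tendsto (fun s : ℝ => ‖s • (1 : Matrix (Fin r) (Fin r) ℝ)‖) (𝓝 0) (𝓝 0) := by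
      have : Continuous fun s : ℝ => ‖s • (1 : Matrix (Fin r) (Fin r) ℝ)‖ := by fun_prop
      simpa using this.tendsto 0
    exact (hc.mono_left nhdsWithin_le_nhds).eventually (gt_mem_nhds hη)
  obtain ⟨s, hs1, hs2⟩ := (h1.and h2).exists
  refine ⟨R + s • 1, ?_, by simpa using hs2.le⟩
  rw [Polynomial.IsRoot, Matrix.eval_charpoly, sub_neg_eq_add] at hs1
  rwa [add_comm, Matrix.smul_one_eq_diagonal]

theorem rank_mul_mul_transpose {m n r : ℕ} {U : Matrix (Fin m) (Fin r) ℝ}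
    {V : Matrix (Fin n) (Fin r) ℝ} {R : Matrix (Fin r) (Fin r) ℝ} (hU : HasOrthonormalCols U)
    (hV : HasOrthonormalCols V) (hR : R.det ≠ 0) : (U * R * Vᵀ).rank = r := by
  have hU' : Uᵀ * U = 1 := hU
  have hV' : Vᵀ * V = 1 := hV
  apply le_antisymm
  · exact (Matrix.rank_mul_le_right _ _).trans (by simpa using Matrix.rank_le_height Vᵀ)
  · have h1 : Uᵀ * (U * R * Vᵀ) * V = R := by
      rw [Matrix.mul_assoc U, ← Matrix.mul_assoc Uᵀ, hU', Matrix.one_mul, Matrix.mul_assoc, hV',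
        Matrix.mul_one]
    have h2 : R.rank = r := by
      simpa using Matrix.rank_of_isUnit R ((Matrix.isUnit_iff_isUnit_det R).2 hR.isUnit)
    calc r = (Uᵀ * (U * R * Vᵀ) * V).rank := by rw [h1, h2]
      _ ≤ (Uᵀ * (U * R * Vᵀ)).rank := Matrix.rank_mul_le_left _ _
      _ ≤ (U * R * Vᵀ).rank := Matrix.rank_mul_le_right _ _

/-- A rank-`r` matrix is recovered from its product with `V`, its product with `Uᵀ` and the
`r × r` core `Uᵀ Y V`, if the core is invertible. -/
theorem eq_mul_inv_mul_of_rank_eq {m n r : ℕ} {Y : Matrix (Fin m) (Fin n) ℝ} (hY : Y.rank = r)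
    (U : Matrix (Fin m) (Fin r) ℝ) (V : Matrix (Fin n) (Fin r) ℝ) (hM : (Uᵀ * Y * V).det ≠ 0) :
    Y = Y * V * (Uᵀ * Y * V)⁻¹ * (Uᵀ * Y) := by
  have hu : IsUnit (Uᵀ * Y * V).det := hM.isUnit
  have hrank : (Uᵀ * Y * V).rank = r := by
    simpa using Matrix.rank_of_isUnit _ ((Matrix.isUnit_iff_isUnit_det _).2 hu)
  -- The invertible core forces `Y * V` to have rank at least `r`, so `Y` and `Y * V` have the same
  -- range. Each `Y x` is then `Y V y`, and the core's inverse recovers `y` from `Uᵀ Y x`.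
  have hle : LinearMap.range (Y * V).mulVecLin ≤ LinearMap.range Y.mulVecLin := by
    rw [Matrix.mulVecLin_mul]
    exact LinearMap.range_comp_le_range _ _
  have hYV : r ≤ (Y * V).rank := by
    refine hrank.symm.le.trans ?_
    rw [Matrix.mul_assoc]
    exact Matrix.rank_mul_le_right _ _
  have heq : LinearMap.range (Y * V).mulVecLin = LinearMap.range Y.mulVecLin :=
    Submodule.eq_of_le_of_finrank_le hle (by
      change Y.rank ≤ (Y * V).rank
      rw [hY]; exact hYV)
  apply Matrix.toLin'.injective
  ext1 j
  ext1
  simp only [LinearMap.comp_apply, Matrix.toLin'_apply]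
  set x := LinearMap.single ℝ (fun _ : Fin n => ℝ) j 1
  obtain ⟨y, hy⟩ : Y *ᵥ x ∈ LinearMap.range (Y * V).mulVecLin := by
    rw [heq]; exact ⟨x, rfl⟩
  rw [Matrix.mulVecLin_apply] at hy
  have h3 : (Uᵀ * Y) *ᵥ x = (Uᵀ * Y * V) *ᵥ y := by
    rw [← Matrix.mulVec_mulVec, ← hy, Matrix.mulVec_mulVec, Matrix.mul_assoc]
  rw [← Matrix.mulVec_mulVec, h3, Matrix.mulVec_mulVec, Matrix.mul_assoc (Y * V),
    Matrix.nonsing_inv_mul _ hu, Matrix.mul_one, hy]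

/-- Along a rank-`r` curve `γ` through `U R Vᵀ`, with `P`, `Q` the complementary projections, `P γ Q
= (P γ V) (Uᵀ γ V)⁻¹ (Uᵀ γ Q)` near the base point. Both outer factors vanish there, so the product
has zero derivative. -/
theorem complProj_mul_tangent_mul_complProj {m n r : ℕ} {U : Matrix (Fin m) (Fin r) ℝ}
    {V : Matrix (Fin n) (Fin r) ℝ} {R : Matrix (Fin r) (Fin r) ℝ} (hU : HasOrthonormalCols U)
    (hV : HasOrthonormalCols V) (hR : R.det ≠ 0) {W : Matrix (Fin m) (Fin n) ℝ}
    (hW : W ∈ rankTangentSpace r (U * R * Vᵀ)) : (1 - U * Uᵀ) * W * (1 - V * Vᵀ) = 0 := by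
  have hU' : Uᵀ * U = 1 := hU
  have hV' : Vᵀ * V = 1 := hV
  induction hW using Submodule.span_induction with
  | zero => simp
  | add X Y _ _ hX hY => rw [Matrix.mul_add, Matrix.add_mul, hX, hY, add_zero]
  | smul c X _ hX => rw [Matrix.mul_smul, Matrix.smul_mul, hX, smul_zero]
  | mem W hW =>
    obtain ⟨γ, h0, hrk, hd⟩ := hW
    have hc : ContinuousAt γ 0 := hd.continuousAt
    set P := 1 - U * Uᵀ with hP
    set Q := 1 - V * Vᵀ with hQ
    have hPU : P * U = 0 := by rw [hP, Matrix.sub_mul, Matrix.mul_assoc, hU']; simp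
    have hVQ : Vᵀ * Q = 0 := by rw [hQ, Matrix.mul_sub, ← Matrix.mul_assoc, hV']; simp
    have hM0 : Uᵀ * γ 0 * V = R := by
      rw [h0, Matrix.mul_assoc U, ← Matrix.mul_assoc Uᵀ, hU', Matrix.one_mul, Matrix.mul_assoc,
        hV', Matrix.mul_one]
    have hMc : ContinuousAt (fun s => Uᵀ * γ s * V) 0 := by
      have : Continuous fun X : Matrix (Fin m) (Fin n) ℝ => Uᵀ * X * V := by fun_prop
      exact this.continuousAt.comp hc
    have hdetc : ContinuousAt (fun s => (Uᵀ * γ s * V).det) 0 := by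
      have : Continuous fun X : Matrix (Fin r) (Fin r) ℝ => X.det := by fun_prop
      exact this.continuousAt.comp hMc
    have hdet : ∀ᶠ s in 𝓝 (0 : ℝ), (Uᵀ * γ s * V).det ≠ 0 :=
      hdetc.eventually_ne (by simpa only [hM0] using hR)
    have hinv : ContinuousAt (fun s => (Uᵀ * γ s * V)⁻¹) 0 := by
      have h1 : Continuous fun X : Matrix (Fin r) (Fin r) ℝ => X.adjugate := by fun_prop
      have h2 := (hdetc.inv₀ (by simpa only [hM0] using hR)).smul (h1.continuousAt.comp hMc)
      simp only [Matrix.inv_def, Ring.inverse_eq_inv']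
      exact h2
    -- the left factor vanishes to first order, the right factor tends to zero
    have hD : Tendsto (fun s => s⁻¹ • (P * γ s * V)) (𝓝[≠] 0) (𝓝 (P * W * V)) := by
      have h1 := ((hd.hasDerivWithinAt (s := univ)).matrix_mul_mul P V).hasDerivAt univ_mem
      have h2 := h1.tendsto_slope_zero
      have h3 : P * γ 0 * V = 0 := by
        rw [h0, ← Matrix.mul_assoc, ← Matrix.mul_assoc, hPU]; simp
      simp only [h3, zero_add, sub_zero] at h2
      exact h2
    have hG : Tendsto (fun s => (Uᵀ * γ s * V)⁻¹ * (Uᵀ * γ s * Q)) (𝓝[≠] 0) (𝓝 0) := by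
      have h1 : Continuous fun X : Matrix (Fin m) (Fin n) ℝ => Uᵀ * X * Q := by fun_prop
      have hm : Continuous fun p : Matrix (Fin r) (Fin r) ℝ × Matrix (Fin r) (Fin n) ℝ =>
          p.1 * p.2 := by fun_prop
      have h2 := (hm.tendsto _).comp (hinv.tendsto.prodMk_nhds (h1.continuousAt.comp hc).tendsto)
      have h3 : Uᵀ * γ 0 * Q = 0 := by
        rw [h0, Matrix.mul_assoc Uᵀ, Matrix.mul_assoc _ Vᵀ, hVQ]; simp
      have h4 := h2.mono_left (nhdsWithin_le_nhds (s := {0}ᶜ))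
      simp only [Function.comp_apply, h3, Matrix.mul_zero] at h4
      exact h4
    have hprod : Tendsto (fun s => s⁻¹ • (P * γ s * Q)) (𝓝[≠] 0) (𝓝 0) := by
      have hm : Continuous fun p : Matrix (Fin m) (Fin r) ℝ × Matrix (Fin r) (Fin n) ℝ =>
          p.1 * p.2 := by fun_prop
      have h1 := (hm.tendsto (P * W * V, 0)).comp (hD.prodMk_nhds hG)
      simp only [Matrix.mul_zero] at h1
      refine h1.congr' ?_
      filter_upwards [mem_nhdsWithin_of_mem_nhds hrk, mem_nhdsWithin_of_mem_nhds hdet]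
        with s hs hs'
      have h2 := eq_mul_inv_mul_of_rank_eq (show (γ s).rank = r from hs) U V hs'
      simp only [Function.comp_apply, Matrix.smul_mul]
      congr 1
      conv_rhs => rw [h2]
      simp only [Matrix.mul_assoc]
    have hlim : Tendsto (fun s => s⁻¹ • (P * γ s * Q)) (𝓝[≠] 0) (𝓝 (P * W * Q)) := by
      have h1 := ((hd.hasDerivWithinAt (s := univ)).matrix_mul_mul P Q).hasDerivAt univ_mem
      have h3 : P * γ 0 * Q = 0 := by
        rw [h0, ← Matrix.mul_assoc, ← Matrix.mul_assoc, hPU]; simp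
      have h2 := h1.tendsto_slope_zero
      simp only [h3, zero_add, sub_zero] at h2
      exact h2
    exact tendsto_nhds_unique hlim hprod

theorem norm_complProj_mul_complProj_le {m n r : ℕ} {U : Matrix (Fin m) (Fin r) ℝ}
    {V : Matrix (Fin n) (Fin r) ℝ} {R : Matrix (Fin r) (Fin r) ℝ} (hU : HasOrthonormalCols U)
    (hV : HasOrthonormalCols V) (hR : R.det ≠ 0) (X : Matrix (Fin m) (Fin n) ℝ) :
    ‖(1 - U * Uᵀ) * X * (1 - V * Vᵀ)‖ ≤ ‖X - tangentProj r (U * R * Vᵀ) X‖ := by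
  have h1 : (1 - U * Uᵀ) * tangentProj r (U * R * Vᵀ) X * (1 - V * Vᵀ) = 0 :=
    complProj_mul_tangent_mul_complProj hU hV hR (Submodule.starProjection_apply_mem _ _)
  have h2 : (1 - U * Uᵀ) * X * (1 - V * Vᵀ) =
      (1 - U * Uᵀ) * (X - tangentProj r (U * R * Vᵀ) X) * (1 - V * Vᵀ) := by
    rw [Matrix.mul_sub _ X, Matrix.sub_mul (_ * X), h1, sub_zero]
  rw [h2]
  exact (norm_mul_complProj_le hV _).trans (norm_complProj_mul_le hU _)

/-! ### One step of the integrator -/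

theorem HasOrthonormalCols.complProj_mul {m r q : ℕ} {U : Matrix (Fin m) (Fin r) ℝ}
    (hU : HasOrthonormalCols U) (R : Matrix (Fin r) (Fin q) ℝ) : (1 - U * Uᵀ) * (U * R) = 0 := by
  have hU' : Uᵀ * U = 1 := hU
  rw [← Matrix.mul_assoc, Matrix.sub_mul, Matrix.mul_assoc U, hU']
  simp

theorem HasOrthonormalCols.mul_complProj {n r p : ℕ} {V : Matrix (Fin n) (Fin r) ℝ}
    (hV : HasOrthonormalCols V) (R : Matrix (Fin p) (Fin r) ℝ) : R * Vᵀ * (1 - V * Vᵀ) = 0 := by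
  have hV' : Vᵀ * V = 1 := hV
  rw [Matrix.mul_assoc, Matrix.mul_sub, ← Matrix.mul_assoc Vᵀ, hV']
  simp

/-- The range of the basis `U₁` computed in the K-step contains the shifted exact solution
`Y₀ + A(t₁) - A(t₀)` up to a small error. -/
theorem norm_complProj_mul_le_of_KStep {m n r : ℕ}
    {F : ℝ → Matrix (Fin m) (Fin n) ℝ → Matrix (Fin m) (Fin n) ℝ}
    {A : ℝ → Matrix (Fin m) (Fin n) ℝ} {K : ℝ → Matrix (Fin m) (Fin r) ℝ}
    {V₀ : Matrix (Fin n) (Fin r) ℝ} {U₁ : Matrix (Fin m) (Fin r) ℝ}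
    {R : Matrix (Fin r) (Fin r) ℝ} {a h L B ε ρ e : ℝ} (hh : 0 < h) (hL : 0 ≤ L) (hB : 0 ≤ B)
    (hε : 0 ≤ ε) (hA : IsSolutionOn F a (a + h) A)
    (hLip : ∀ t ∈ Icc a (a + h), ∀ Y Y' : Matrix (Fin m) (Fin n) ℝ,
      ‖F t Y - F t Y'‖ ≤ L * ‖Y - Y'‖)
    (hbd : ∀ t ∈ Icc a (a + h), ∀ Y : Matrix (Fin m) (Fin n) ℝ, ‖F t Y‖ ≤ B)
    (hV₀ : HasOrthonormalCols V₀) (hU₁ : HasOrthonormalCols U₁)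
    (hK : IsSolutionOn (fun t X => F t (X * V₀ᵀ) * V₀) a (a + h) K) (hKR : K (a + h) = U₁ * R)
    (hnormal : ∀ t ∈ Icc a (a + h), ∀ R' : Matrix (Fin r) (Fin r) ℝ, R'.det ≠ 0 →
      ‖U₁ * R' * V₀ᵀ - A t‖ < ρ →
      ‖(1 - U₁ * U₁ᵀ) * F t (U₁ * R' * V₀ᵀ) * (1 - V₀ * V₀ᵀ)‖ ≤ ε)
    (he : ‖K a * V₀ᵀ - A a‖ ≤ e) (hρ : e + 2 * B * h + h < ρ) :
    ‖(1 - U₁ * U₁ᵀ) * (K a * V₀ᵀ + (A (a + h) - A a))‖ ≤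
      L * (e + 2 * B * h) * h + (ε + L * (e + 2 * B * h + h)) * h := by
  have hV₀' : V₀ᵀ * V₀ = 1 := hV₀
  have he0 : 0 ≤ e := (norm_nonneg _).trans he
  have hb : a + h ∈ Icc a (a + h) := ⟨by linarith, le_rfl⟩
  have hAinc : ∀ t ∈ Icc a (a + h), ‖A t - A a‖ ≤ B * h :=
    norm_sub_le_of_hasDerivWithinAt hB hA fun t ht => hbd t ht _
  have hKinc : ∀ t ∈ Icc a (a + h), ‖K t - K a‖ ≤ B * h :=
    norm_sub_le_of_hasDerivWithinAt hB hK fun t ht =>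
      (norm_mul_le_of_orthonormal hV₀ _).trans (hbd t ht _)
  -- The two times are independent because the fixed endpoint `K (a + h)` is later compared with `A
  -- t` at every `t`.
  have hdist : ∀ s ∈ Icc a (a + h), ∀ t ∈ Icc a (a + h),
      ‖K s * V₀ᵀ - A t‖ ≤ e + 2 * B * h := by
    intro s hs t ht
    have h1 : K s * V₀ᵀ - A t = (K s - K a) * V₀ᵀ + (K a * V₀ᵀ - A a) - (A t - A a) := by
      rw [Matrix.sub_mul]; abel
    have h2 : ‖(K s - K a) * V₀ᵀ‖ ≤ B * h := by
      rw [norm_mul_transpose_eq hV₀]; exact hKinc s hs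
    rw [h1]
    have h3 := norm_sub_le ((K s - K a) * V₀ᵀ + (K a * V₀ᵀ - A a)) (A t - A a)
    have h4 := norm_add_le ((K s - K a) * V₀ᵀ) (K a * V₀ᵀ - A a)
    linarith [hAinc t ht]
  set P := 1 - U₁ * U₁ᵀ with hP
  set Q := 1 - V₀ * V₀ᵀ with hQ
  set W := K a * V₀ᵀ + (A (a + h) - A a) with hW
  have hrange : ‖P * (W * V₀) * V₀ᵀ‖ ≤ L * (e + 2 * B * h) * h := by
    have hd : ∀ t ∈ Icc a (a + h), HasDerivWithinAt (fun t => A t * V₀ - K t)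
        (F t (A t) * V₀ - F t (K t * V₀ᵀ) * V₀) (Icc a (a + h)) t := fun t ht => by
      have h1 := ((hA t ht).matrix_mul_mul 1 V₀).fun_sub (hK t ht)
      simp only [Matrix.one_mul] at h1
      exact h1
    have hbound := norm_sub_le_of_hasDerivWithinAt (C := L * (e + 2 * B * h)) (by positivity) hd
      (fun t ht => by
        rw [← Matrix.sub_mul]
        refine (norm_mul_le_of_orthonormal hV₀ _).trans ((hLip t ht _ _).trans ?_)
        rw [norm_sub_rev]
        exact mul_le_mul_of_nonneg_left (hdist t ht t ht) hL) (a + h) hb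
    have heq : P * (W * V₀) =
        P * ((A (a + h) * V₀ - K (a + h)) - (A a * V₀ - K a)) := by
      have h1 : W * V₀ = ((A (a + h) * V₀ - K (a + h)) - (A a * V₀ - K a)) +
          K (a + h) := by
        rw [hW, Matrix.add_mul, Matrix.mul_assoc, hV₀', Matrix.sub_mul]
        simp only [Matrix.mul_one]
        abel
      rw [h1, Matrix.mul_add, hKR, hU₁.complProj_mul, add_zero]
    rw [norm_mul_transpose_eq hV₀, heq]
    exact (norm_complProj_mul_le hU₁ _).trans hbound
  have hcorange : ‖P * W * Q‖ ≤ (ε + L * (e + 2 * B * h + h)) * h := by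
    -- Moving `R` by at most `h` to make it invertible costs one extra `h` in the distance to `A`,
    -- of the same order as the other terms; this is the last `h` in `hρ`.
    obtain ⟨R', hR', hRR'⟩ := exists_det_ne_zero_norm_sub_le R hh
    have hYdist : ∀ t ∈ Icc a (a + h), ‖U₁ * R' * V₀ᵀ - A t‖ ≤ e + 2 * B * h + h := by
      intro t ht
      have h1 : U₁ * R' * V₀ᵀ - A t = U₁ * (R' - R) * V₀ᵀ + (K (a + h) * V₀ᵀ - A t) := by
        rw [hKR, Matrix.mul_sub, Matrix.sub_mul]; abel
      have h2 : ‖U₁ * (R' - R) * V₀ᵀ‖ ≤ h := by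
        rwa [norm_mul_transpose_eq hV₀, norm_mul_left_eq hU₁]
      rw [h1]
      linarith [norm_add_le (U₁ * (R' - R) * V₀ᵀ) (K (a + h) * V₀ᵀ - A t), hdist _ hb t ht]
    have hbound := norm_sub_le_of_hasDerivWithinAt (C := ε + L * (e + 2 * B * h + h))
      (by positivity) (fun t ht => (hA t ht).matrix_mul_mul P Q)
      (fun t ht => by
        have h1 : P * F t (A t) * Q = P * F t (U₁ * R' * V₀ᵀ) * Q -
            P * (F t (U₁ * R' * V₀ᵀ) - F t (A t)) * Q := by
          rw [Matrix.mul_sub P, Matrix.sub_mul _ _ Q]; abel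
        have h2 := hnormal t ht R' hR' ((hYdist t ht).trans_lt hρ)
        have h3 : ‖P * (F t (U₁ * R' * V₀ᵀ) - F t (A t)) * Q‖ ≤ L * (e + 2 * B * h + h) :=
          (norm_mul_complProj_le hV₀ _).trans ((norm_complProj_mul_le hU₁ _).trans
            ((hLip t ht _ _).trans (mul_le_mul_of_nonneg_left (hYdist t ht) hL)))
        rw [h1]
        exact (norm_sub_le _ _).trans (add_le_add h2 h3)) (a + h) hb
    have heq : P * W * Q = P * A (a + h) * Q - P * A a * Q := by
      rw [hW, Matrix.mul_add P, Matrix.add_mul _ _ Q, Matrix.mul_assoc P (K a * V₀ᵀ) Q,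
        hV₀.mul_complProj, Matrix.mul_zero, zero_add, Matrix.mul_sub P, Matrix.sub_mul _ _ Q]
    rw [heq]
    exact hbound
  have hsplit : P * W = P * (W * V₀) * V₀ᵀ + P * W * Q := by
    rw [hQ, Matrix.mul_sub (P * W)]
    simp only [Matrix.mul_assoc, Matrix.mul_one]
    abel
  rw [hsplit]
  exact (norm_add_le _ _).trans (add_le_add hrange hcorange)

/-- The error recursion of the integrator. -/
theorem norm_integratorStep_sub_le {m n r : ℕ}
    {F : ℝ → Matrix (Fin m) (Fin n) ℝ → Matrix (Fin m) (Fin n) ℝ}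
    {A : ℝ → Matrix (Fin m) (Fin n) ℝ} {U₀ U₁ : Matrix (Fin m) (Fin r) ℝ}
    {S₀ S₁ : Matrix (Fin r) (Fin r) ℝ} {V₀ V₁ : Matrix (Fin n) (Fin r) ℝ}
    {a h L B ε ρ e : ℝ} (hh : 0 < h) (hL : 0 ≤ L) (hB : 0 ≤ B)
    (hε : 0 ≤ ε) (hA : IsSolutionOn F a (a + h) A)
    (hLip : ∀ t ∈ Icc a (a + h), ∀ Y Y' : Matrix (Fin m) (Fin n) ℝ,
      ‖F t Y - F t Y'‖ ≤ L * ‖Y - Y'‖)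
    (hbd : ∀ t ∈ Icc a (a + h), ∀ Y : Matrix (Fin m) (Fin n) ℝ, ‖F t Y‖ ≤ B)
    (hnormal : ∀ t ∈ Icc a (a + h), ∀ Y ∈ rankManifold m n r, ‖Y - A t‖ < ρ →
      ‖F t Y - tangentProj r Y (F t Y)‖ ≤ ε)
    (hU₀ : HasOrthonormalCols U₀) (hV₀ : HasOrthonormalCols V₀)
    (hstep : IsIntegratorStep F a h U₀ S₀ V₀ U₁ S₁ V₁)
    (he : ‖U₀ * S₀ * V₀ᵀ - A a‖ ≤ e) (hρ : e + 2 * B * h + h < ρ) {θ : ℝ}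
    (hθ : θ = 2 * (L * (e + 2 * B * h) * h + (ε + L * (e + 2 * B * h + h)) * h)) :
    ‖U₁ * S₁ * V₁ᵀ - A (a + h)‖ ≤ e + θ + L * (e + 4 * B * h + θ) * h := by
  obtain ⟨⟨K, R, hK, hK0, hKR, hU₁, -⟩, ⟨M, R', hM, hM0, hMR, hV₁, -⟩, ⟨S, hS, hS0, hS1⟩⟩ := hstep
  have he0 : 0 ≤ e := (norm_nonneg _).trans he
  have hb : a + h ∈ Icc a (a + h) := ⟨by linarith, le_rfl⟩
  have hAinc : ∀ t ∈ Icc a (a + h), ‖A t - A a‖ ≤ B * h :=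
    norm_sub_le_of_hasDerivWithinAt hB hA fun t ht => hbd t ht _
  set Y₀ := U₀ * S₀ * V₀ᵀ with hY₀
  set W := Y₀ + (A (a + h) - A a) with hW
  have hleft : ‖(1 - U₁ * U₁ᵀ) * W‖ ≤
      L * (e + 2 * B * h) * h + (ε + L * (e + 2 * B * h + h)) * h := by
    have h1 := norm_complProj_mul_le_of_KStep hh hL hB hε hA hLip hbd hV₀ hU₁ hK hKR
      (fun t ht R'' hR'' hlt => (norm_complProj_mul_complProj_le hU₁ hV₀ hR'' _).trans
        (hnormal t ht _ (rank_mul_mul_transpose hU₁ hV₀ hR'') hlt)) (by rwa [hK0]) hρ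
    rwa [hK0] at h1
  have hright : ‖W * (1 - V₁ * V₁ᵀ)‖ ≤
      L * (e + 2 * B * h) * h + (ε + L * (e + 2 * B * h + h)) * h := by
    have hY₀T : M a * U₀ᵀ = Y₀ᵀ := by
      rw [hM0, hY₀]; simp only [Matrix.transpose_mul, Matrix.transpose_transpose, Matrix.mul_assoc]
    -- The L-step is the K-step of the transposed problem. Since the K-step estimate assumes only
    -- the double-projection bound, that bound is transposed directly and `tangentProj` need not be.
    have h1 := norm_complProj_mul_le_of_KStep (F := fun t X => (F t Xᵀ)ᵀ) (A := fun t => (A t)ᵀ)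
      (K := M) (V₀ := U₀) (U₁ := V₁) (R := R') (ρ := ρ) (e := e) (ε := ε) hh hL hB hε
      (fun t ht => by simpa using (hA t ht).matrix_transpose)
      (fun t ht Y Y' => by
        have h2 := hLip t ht Yᵀ Y'ᵀ
        rw [← Matrix.transpose_sub, Matrix.frobenius_norm_transpose] at h2 ⊢
        exact h2)
      (fun t ht Y => by rw [Matrix.frobenius_norm_transpose]; exact hbd t ht _) hU₀ hV₁
      (fun t ht => by simpa using hM t ht) hMR
      (fun t ht R'' hR'' hlt => by
        have hT : (V₁ * R'' * U₀ᵀ)ᵀ = U₀ * R''ᵀ * V₁ᵀ := by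
          simp only [Matrix.transpose_mul, Matrix.transpose_transpose, Matrix.mul_assoc]
        have hdet : R''ᵀ.det ≠ 0 := by rwa [Matrix.det_transpose]
        rw [← Matrix.frobenius_norm_transpose, Matrix.transpose_sub, hT,
          Matrix.transpose_transpose] at hlt
        have h2 := (norm_complProj_mul_complProj_le hU₀ hV₁ hdet _).trans
          (hnormal t ht _ (rank_mul_mul_transpose hU₀ hV₁ hdet) hlt)
        rw [← Matrix.frobenius_norm_transpose, hT]
        simpa [Matrix.mul_assoc] using h2)
      (by rw [hY₀T, ← Matrix.transpose_sub, Matrix.frobenius_norm_transpose]; exact he) hρ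
    rw [hY₀T, ← Matrix.transpose_sub, ← Matrix.transpose_add,
      ← Matrix.frobenius_norm_transpose] at h1
    simpa using h1
  have hproj : ∀ X : Matrix (Fin m) (Fin n) ℝ, ‖U₁ * (U₁ᵀ * X * V₁) * V₁ᵀ‖ ≤ ‖X‖ := fun X => by
    rw [norm_mul_transpose_eq hV₁, norm_mul_left_eq hU₁]
    exact (norm_mul_le_of_orthonormal hV₁ _).trans (norm_transpose_mul_le hU₁ _)
  have hcompl : ∀ X : Matrix (Fin m) (Fin n) ℝ, X - U₁ * (U₁ᵀ * X * V₁) * V₁ᵀ =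
      (1 - U₁ * U₁ᵀ) * X + U₁ * (U₁ᵀ * (X * (1 - V₁ * V₁ᵀ))) := fun X => by
    simp only [Matrix.mul_sub, Matrix.sub_mul, Matrix.mul_one, Matrix.one_mul, Matrix.mul_assoc]
    abel
  -- `θ` is the sum of the equal bounds on the left and right projection defects of `W`.
  have hWproj : ‖W - U₁ * (U₁ᵀ * W * V₁) * V₁ᵀ‖ ≤ θ := by
    have h2 : ‖U₁ * (U₁ᵀ * (W * (1 - V₁ * V₁ᵀ)))‖ ≤ ‖W * (1 - V₁ * V₁ᵀ)‖ := by
      rw [norm_mul_left_eq hU₁]; exact norm_transpose_mul_le hU₁ _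
    rw [hcompl]
    linarith [norm_add_le ((1 - U₁ * U₁ᵀ) * W) (U₁ * (U₁ᵀ * (W * (1 - V₁ * V₁ᵀ))))]
  have hS0' : S a = U₁ᵀ * Y₀ * V₁ := by
    rw [hS0, hY₀]
    simp only [Matrix.transpose_mul, Matrix.transpose_transpose, Matrix.mul_assoc]
  -- `Y₀` is `W` minus an increment of `A` of size at most `B h`, so its projection defect exceeds
  -- that of `W` by at most `2 B h`.
  have hY₀proj : ‖U₁ * S a * V₁ᵀ - Y₀‖ ≤ θ + 2 * B * h := by
    have h1 : U₁ * S a * V₁ᵀ - Y₀ = ((A (a + h) - A a) -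
        U₁ * (U₁ᵀ * (A (a + h) - A a) * V₁) * V₁ᵀ) - (W - U₁ * (U₁ᵀ * W * V₁) * V₁ᵀ) := by
      rw [hS0', hW]
      simp only [Matrix.mul_add, Matrix.add_mul]
      abel
    rw [h1]
    linarith [norm_sub_le ((A (a + h) - A a) - U₁ * (U₁ᵀ * (A (a + h) - A a) * V₁) * V₁ᵀ)
      (W - U₁ * (U₁ᵀ * W * V₁) * V₁ᵀ), norm_sub_le (A (a + h) - A a)
        (U₁ * (U₁ᵀ * (A (a + h) - A a) * V₁) * V₁ᵀ), hproj (A (a + h) - A a), hAinc _ hb]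
  have hSinc : ∀ t ∈ Icc a (a + h), ‖S t - S a‖ ≤ B * h :=
    norm_sub_le_of_hasDerivWithinAt hB hS fun t ht =>
      (norm_mul_le_of_orthonormal hV₁ _).trans
        ((norm_transpose_mul_le hU₁ _).trans (hbd t ht _))
  have hdist : ∀ t ∈ Icc a (a + h), ‖U₁ * S t * V₁ᵀ - A t‖ ≤ e + 4 * B * h + θ := by
    intro t ht
    have h1 : U₁ * S t * V₁ᵀ - A t = U₁ * (S t - S a) * V₁ᵀ + (U₁ * S a * V₁ᵀ - Y₀) +
        (Y₀ - A a) - (A t - A a) := by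
      rw [Matrix.mul_sub, Matrix.sub_mul]; abel
    have h2 : ‖U₁ * (S t - S a) * V₁ᵀ‖ ≤ B * h := by
      rw [norm_mul_transpose_eq hV₁, norm_mul_left_eq hU₁]; exact hSinc t ht
    rw [h1]
    refine (norm_sub_le _ _).trans ?_
    have h3 := norm_add₃_le (a := U₁ * (S t - S a) * V₁ᵀ) (b := U₁ * S a * V₁ᵀ - Y₀)
      (c := Y₀ - A a)
    linarith [hAinc t ht]
  have hθ0 : 0 ≤ θ := (norm_nonneg _).trans hWproj
  -- `S` is compared with `U₁ᵀ A V₁`. Their initial values differ, but by the choice of `W` the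
  -- difference `S₁ - U₁ᵀ W V₁` is exactly the increment of `S - U₁ᵀ A V₁` over the step.
  have hgal : ‖U₁ * S₁ * V₁ᵀ - U₁ * (U₁ᵀ * W * V₁) * V₁ᵀ‖ ≤ L * (e + 4 * B * h + θ) * h := by
    have hbound := norm_sub_le_of_hasDerivWithinAt (C := L * (e + 4 * B * h + θ)) (by positivity)
      (fun t ht => (hS t ht).sub ((hA t ht).matrix_mul_mul U₁ᵀ V₁))
      (fun t ht => by
        rw [← Matrix.sub_mul, ← Matrix.mul_sub]
        exact (norm_mul_le_of_orthonormal hV₁ _).trans ((norm_transpose_mul_le hU₁ _).trans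
          ((hLip t ht _ _).trans (mul_le_mul_of_nonneg_left (hdist t ht) hL)))) (a + h) hb
    have heq : S₁ - U₁ᵀ * W * V₁ = (S (a + h) - U₁ᵀ * A (a + h) * V₁) -
        (S a - U₁ᵀ * A a * V₁) := by
      rw [hS0', hS1, hW]
      simp only [Matrix.mul_add, Matrix.add_mul, Matrix.mul_sub, Matrix.sub_mul]
      abel
    rw [← Matrix.sub_mul, ← Matrix.mul_sub, norm_mul_transpose_eq hV₁, norm_mul_left_eq hU₁, heq]
    exact hbound
  have hfinal : U₁ * S₁ * V₁ᵀ - A (a + h) =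
      (U₁ * S₁ * V₁ᵀ - U₁ * (U₁ᵀ * W * V₁) * V₁ᵀ) - (W - U₁ * (U₁ᵀ * W * V₁) * V₁ᵀ) +
        (Y₀ - A a) := by
    rw [hW]; abel
  rw [hfinal]
  refine (norm_add_le _ _).trans ?_
  linarith [norm_sub_le (U₁ * S₁ * V₁ᵀ - U₁ * (U₁ᵀ * W * V₁) * V₁ᵀ)
    (W - U₁ * (U₁ᵀ * W * V₁) * V₁ᵀ)]

/-! ### Error propagation -/

/-- One step of the discrete Gronwall inequality for the error recursion of the integrator. -/
theorem exp_mul_recursion_step {a g h δ : ℝ} (ha : 0 ≤ a) (hg : 0 ≤ g) (hh : 0 ≤ h) (hδ : 0 ≤ δ)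
    (k : ℕ) :
    (1 + a * h) * (Real.exp (a * (k * h)) * (δ + k * h * g)) + h * g ≤
      Real.exp (a * ((k + 1 : ℕ) * h)) * (δ + (k + 1 : ℕ) * h * g) := by
  have h1 : Real.exp (a * ((k + 1 : ℕ) * h)) = Real.exp (a * h) * Real.exp (a * (k * h)) := by
    rw [← Real.exp_add]; congr 1; push_cast; ring
  have h2 : 1 + a * h ≤ Real.exp (a * h) := by linarith [Real.add_one_le_exp (a * h)]
  have h3 : 1 ≤ Real.exp (a * ((k + 1 : ℕ) * h)) := Real.one_le_exp (by positivity)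
  have h4 : 0 ≤ Real.exp (a * (k * h)) * (δ + k * h * g) := by positivity
  calc (1 + a * h) * (Real.exp (a * (k * h)) * (δ + k * h * g)) + h * g
      ≤ Real.exp (a * h) * (Real.exp (a * (k * h)) * (δ + k * h * g)) +
          Real.exp (a * ((k + 1 : ℕ) * h)) * (h * g) :=
        add_le_add (mul_le_mul_of_nonneg_right h2 h4)
          (le_mul_of_one_le_left (by positivity) h3)
    _ = Real.exp (a * ((k + 1 : ℕ) * h)) * (δ + (k + 1 : ℕ) * h * g) := by
        rw [h1]; push_cast; ring

/-- The one-step error bound is of the form `(1 + a h) e + h (b h + c ε)`. -/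
theorem step_bound_le {L B T e ε h θ : ℝ} (hL : 0 ≤ L) (hB : 0 ≤ B) (he : 0 ≤ e) (hε : 0 ≤ ε)
    (hh : 0 ≤ h) (hT : h ≤ T)
    (hθ : θ = 2 * (L * (e + 2 * B * h) * h + (ε + L * (e + 2 * B * h + h)) * h)) :
    e + θ + L * (e + 4 * B * h + θ) * h ≤
      (1 + (4 * L * (1 + L * T) + L) * h) * e +
        h * (((8 * L * B + 2 * L) * (1 + L * T) + 4 * L * B) * h + 2 * (1 + L * T) * ε) := by
  have h1 : θ = h * (4 * L * e + (8 * L * B + 2 * L) * h + 2 * ε) := by rw [hθ]; ring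
  have h0 : 0 ≤ θ := by rw [h1]; positivity
  -- The product of `h` with `θ` is of second order; trading one `h` for `T` keeps the bound linear
  -- in `e` and `ε`.
  have h2 : L * h * θ ≤ L * T * θ := by gcongr
  calc e + θ + L * (e + 4 * B * h + θ) * h
      = e + θ + L * (e + 4 * B * h) * h + L * h * θ := by ring
    _ ≤ e + θ + L * (e + 4 * B * h) * h + L * T * θ := by linarith
    _ = _ := by rw [h1]; ring

theorem theorem4 (L B T : ℝ) :
    ∃ c₀ c₁ c₂ : ℝ, 0 ≤ c₀ ∧ 0 ≤ c₁ ∧ 0 ≤ c₂ ∧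
      ∀ (m n r : ℕ) (F : ℝ → Matrix (Fin m) (Fin n) ℝ → Matrix (Fin m) (Fin n) ℝ)
        (A : ℝ → Matrix (Fin m) (Fin n) ℝ) (ε δ ρ h : ℝ)
        (U : ℕ → Matrix (Fin m) (Fin r) ℝ) (S : ℕ → Matrix (Fin r) (Fin r) ℝ)
        (V : ℕ → Matrix (Fin n) (Fin r) ℝ),
        -- the exact solution
        IsSolutionOn F 0 T A →
        -- `F` is Lipschitz continuous and bounded
        (∀ t ∈ Icc 0 T, ∀ Y Y' : Matrix (Fin m) (Fin n) ℝ, ‖F t Y - F t Y'‖ ≤ L * ‖Y - Y'‖) →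
        (∀ t ∈ Icc 0 T, ∀ Y : Matrix (Fin m) (Fin n) ℝ, ‖F t Y‖ ≤ B) →
        -- the non-tangential part of `F` is `ε`-small on the rank-`r` matrices in the
        -- `ρ`-neighbourhood of the exact solution
        0 ≤ ε →
        (∀ t ∈ Icc 0 T, ∀ Y ∈ rankManifold m n r, ‖Y - A t‖ < ρ →
          ‖F t Y - tangentProj r Y (F t Y)‖ ≤ ε) →
        -- the starting value, in factored form, and its error
        HasOrthonormalCols (U 0) → HasOrthonormalCols (V 0) →
        ‖U 0 * S 0 * (V 0)ᵀ - A 0‖ ≤ δ →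
        -- the steps of the integrator with step size `h`
        0 < h →
        (∀ k : ℕ, ((k + 1 : ℕ) : ℝ) * h ≤ T →
          IsIntegratorStep F (k * h) h (U k) (S k) (V k) (U (k + 1)) (S (k + 1)) (V (k + 1))) →
        -- the neighbourhood is large enough to contain the approximations
        c₀ * δ + c₁ * ε + c₂ * h ≤ ρ →
        ∀ N : ℕ, (N : ℝ) * h ≤ T →
          ‖U N * S N * (V N)ᵀ - A (N * h)‖ ≤ c₀ * δ + c₁ * ε + c₂ * h := by
  -- Absolute values make the constants nonnegative for arbitrary real `L`, `B`, `T`, and only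
  -- weaken the bounds.
  set L' := |L|
  set B' := |B|
  set T' := |T|
  have hL' : 0 ≤ L' := abs_nonneg L
  have hB' : 0 ≤ B' := abs_nonneg B
  have hT' : 0 ≤ T' := abs_nonneg T
  set α := 4 * L' * (1 + L' * T') + L' with hα
  set β := (8 * L' * B' + 2 * L') * (1 + L' * T') + 4 * L' * B' with hβ
  set κ := 2 * (1 + L' * T') with hκ
  have hα0 : 0 ≤ α := by positivity
  have hβ0 : 0 ≤ β := by positivity
  have hκ0 : 0 ≤ κ := by positivity
  -- The summand `2 * B' + 2` is not needed for the error itself: `2 * B' + 1` keeps the auxiliary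
  -- matrices of a step inside the neighbourhood, and one more unit makes the inequality with `ρ`
  -- strict.
  refine ⟨Real.exp (α * T'), Real.exp (α * T') * T' * κ,
    Real.exp (α * T') * T' * β + (2 * B' + 2), by positivity, by positivity, by positivity, ?_⟩
  intro m n r F A ε δ ρ h U S V hA hLip hbd hε hnormal hU0 hV0 hδ hh hstep hρ N hN
  have hδ0 : 0 ≤ δ := (norm_nonneg _).trans hδ
  set g := β * h + κ * ε with hg
  have hg0 : 0 ≤ g := by positivity
  have hexp : ∀ k : ℕ, (k : ℝ) * h ≤ T → Real.exp (α * (k * h)) * (δ + k * h * g) ≤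
      Real.exp (α * T') * δ + Real.exp (α * T') * T' * κ * ε +
        Real.exp (α * T') * T' * β * h := by
    intro k hk
    have hk' : (k : ℝ) * h ≤ T' := hk.trans (le_abs_self T)
    calc Real.exp (α * (k * h)) * (δ + k * h * g)
        ≤ Real.exp (α * T') * (δ + T' * g) := by gcongr
      _ = _ := by rw [hg]; ring
  have key : ∀ k : ℕ, (k : ℝ) * h ≤ T → HasOrthonormalCols (U k) ∧ HasOrthonormalCols (V k) ∧
      ‖U k * S k * (V k)ᵀ - A (k * h)‖ ≤ Real.exp (α * (k * h)) * (δ + k * h * g) := by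
    intro k
    induction k with
    | zero => intro _; exact ⟨hU0, hV0, by simpa using hδ⟩
    | succ k ih =>
      intro hk
      have hk1 : ((k + 1 : ℕ) : ℝ) * h = k * h + h := by push_cast; ring
      have hkh : 0 ≤ (k : ℝ) * h := by positivity
      have hkT : (k : ℝ) * h ≤ T := by linarith
      obtain ⟨hUk, hVk, hek⟩ := ih hkT
      have hst := hstep k hk
      obtain ⟨⟨-, -, -, -, -, hU1, -⟩, ⟨-, -, -, -, -, hV1, -⟩, -⟩ := id hst
      refine ⟨hU1, hV1, ?_⟩
      have hsub : Icc ((k : ℝ) * h) (k * h + h) ⊆ Icc 0 T :=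
        Icc_subset_Icc hkh (by linarith)
      set e := Real.exp (α * (k * h)) * (δ + k * h * g) with he
      have he0 : 0 ≤ e := by positivity
      have hnear : e + 2 * B' * h + h < ρ := by linarith [hexp k hkT]
      have h1 := norm_integratorStep_sub_le hh hL' hB' hε (hA.mono hkh (by linarith))
        (fun t ht Y Y' => (hLip t (hsub ht) Y Y').trans
          (mul_le_mul_of_nonneg_right (le_abs_self L) (norm_nonneg _)))
        (fun t ht Y => (hbd t (hsub ht) Y).trans (le_abs_self B))
        (fun t ht => hnormal t (hsub ht)) hUk hVk hst hek hnear rfl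
      have h2 := step_bound_le hL' hB' he0 hε hh.le
        (show h ≤ T' by linarith [le_abs_self T]) rfl
      have h3 := exp_mul_recursion_step hα0 hg0 hh.le hδ0 k
      rw [hk1] at h3 ⊢
      exact h1.trans (h2.trans h3)
  have hBh : 0 ≤ (2 * B' + 2) * h := by positivity
  linarith [(key N hN).2.2, hexp N hN]
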